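/- Let $d\in\mathbb N$, $1\le p<d$ (so $d\ge 2$), $p^*=\frac{pd}{d-p}$, and let $(e_i)_{1\le i\le d}$ be the canonical basis of $\mathbb R^d$. Functions $\mathbb R^d\to\mathbb R$ are identified when they agree almost everywhere. For $z\in\mathbb R^d$ let $Q+z=\prod_{i=1}^d\,]z_i,z_i+1[$. Let $$\mathbf A^p=\{g\in L^1_{loc}(\mathbb R^d)\;:\; g(\cdot+e_i)-g\in L^p(\mathbb R^d)\ \text{for } i=1,\dots,d\},$$ $$\mathcal E^p=\Big\{g\in L^1_{loc}(\mathbb R^d)\;:\; z\mapsto\int_{Q+z}|g(x)|\,dx\ \text{ belongs to } L^{p^*}(\mathbb R^d)\Big\},$$ and call $g$ $Q$-periodic if $g(\cdot+e_i)=g$ for $i=1,\dots,d$. For $\alpha\in\,]0,1[$ let $\mathcal C^{0,\alpha}(\mathbb R^d)$ be the space of functions that are bounded and uniformly $\alpha$-Hölder continuous on $\mathbb R^d$. For $N\in\mathbb N$ let $I_N=\{k\in\mathbb Z^d : |k|\le N\}$, where $|\cdot|$ is the Euclidean norm. **Proposition.** Let $f\in\mathbf A^p\cap L^\infty(\mathbb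 R^d)$. Then there is a unique $Q$-periodic function $f_{per}\in L^1_{loc}(\mathbb R^d)$ such that $f-f_{per}\in\mathcal E^p$, and it satisfies $$f_{per}=\lim_{N\to\infty}\frac1{\#I_N}\sum_{k\in I_N}f(\cdot+k)\quad\text{in } L^1_{loc}(\mathbb R^d).$$ In addition, for every $\alpha\in\,]0,1[$, if $f\in\mathcal C^{0,\alpha}(\mathbb R^d)$ then $f_{per}\in\mathcal C^{0,\alpha}(\mathbb R^d)$. -/

import Mathlib

open MeasureTheory Filter Topology

noncomputable section

namespace DiscreteGradient

/-- `ℝ^d` with its Euclidean norm and Lebesgue measure. Functions in the spaces below are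
representatives of classes modulo almost-everywhere equality. -/
abbrev Rd (d : ℕ) : Type := EuclideanSpace ℝ (Fin d)

/-- The `i`-th vector of the canonical basis of `ℝ^d`. -/
def basisVec {d : ℕ} (i : Fin d) : Rd d := EuclideanSpace.single i (1 : ℝ)

/-- The `i`-th component of the discrete gradient, `δ_i g = g(· + e_i) - g`. -/
def delta {d : ℕ} (i : Fin d) (g : Rd d → ℝ) : Rd d → ℝ := fun x => g (x + basisVec i) - g x

/-- The space of locally integrable functions whose discrete gradient lies in `(L^p)^d`. -/
def MemBoldA {d : ℕ} (p : ℝ) (g : Rd d → ℝ) : Prop :=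
  LocallyIntegrable g volume ∧ ∀ i : Fin d, MemLp (delta i g) (ENNReal.ofReal p) volume

/-- The translated unit cell `Q + z`, the product of the open intervals `]z_i, z_i + 1[`. -/
def cell {d : ℕ} (z : Rd d) : Set (Rd d) := {x | ∀ i, z i < x i ∧ x i < z i + 1}

/-- The local averaging operator: `M(f)(z)` is the integral of `f` over `Q + z`. -/
def localAvg {d : ℕ} (f : Rd d → ℝ) : Rd d → ℝ := fun z => ∫ x in cell z, f x

/-- The Sobolev exponent `p* = p d / (d - p)`, meaningful for `p < d`. -/
def sobolevExp (d : ℕ) (p : ℝ) : ℝ := p * d / (d - p)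

/-- The space of locally integrable `f` with `M(|f|)` in `L^{p*}`. -/
def MemE {d : ℕ} (p : ℝ) (f : Rd d → ℝ) : Prop :=
  LocallyIntegrable f volume ∧
    MemLp (localAvg fun x => |f x|) (ENNReal.ofReal (sobolevExp d p)) volume

/-- `Q`-periodicity (with respect to translations by `ℤ^d`) of a class of functions. -/
def IsQPeriodic {d : ℕ} (g : Rd d → ℝ) : Prop :=
  ∀ i : Fin d, ∀ᵐ x ∂(volume : Measure (Rd d)), g (x + basisVec i) = g x

/-- `g` is a `Q`-periodic locally integrable function such that `f - g` has `M(|f - g|)` in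
`L^{p*}`. -/
def IsPeriodicPart {d : ℕ} (p : ℝ) (f g : Rd d → ℝ) : Prop :=
  LocallyIntegrable g volume ∧ IsQPeriodic g ∧ MemE p (fun x => f x - g x)

/-- A point of `ℤ^d` seen in `ℝ^d`. -/
def latticePoint {d : ℕ} (k : Fin d → ℤ) : Rd d := WithLp.toLp 2 fun i => (k i : ℝ)

open Classical in
/-- The set `I_N` of all `k` in `ℤ^d` with Euclidean norm at most `N`; the box only serves to
present it as a `Finset`, see `mem_latticeBall`. -/
def latticeBall (d N : ℕ) : Finset (Fin d → ℤ) :=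
  (Fintype.piFinset fun _ : Fin d => Finset.Icc (-(N : ℤ)) (N : ℤ)).filter
    fun k => ‖latticePoint k‖ ≤ (N : ℝ)

theorem mem_latticeBall {d N : ℕ} (k : Fin d → ℤ) :
    k ∈ latticeBall d N ↔ ‖latticePoint k‖ ≤ (N : ℝ) := by
  classical
  unfold latticeBall
  rw [Finset.mem_filter, and_iff_right_iff_imp, Fintype.mem_piFinset]
  intro h i
  have h1 : ‖(latticePoint k) i‖ ≤ (N : ℝ) := (PiLp.norm_apply_le (latticePoint k) i).trans h
  have h2 : |(k i : ℝ)| ≤ (N : ℝ) := by simpa [latticePoint] using h1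
  rw [Finset.mem_Icc, ← abs_le]
  exact_mod_cast h2

/-- The mean `(1 / #I_N) ∑_{k ∈ I_N} f(· + k)`. -/
def latticeMean {d : ℕ} (f : Rd d → ℝ) (N : ℕ) : Rd d → ℝ :=
  fun x => (1 / ((latticeBall d N).card : ℝ)) * ∑ k ∈ latticeBall d N, f (x + latticePoint k)

/-- Convergence in `L^1_loc`: convergence in `L^1(K)` for every compact `K`. -/
def TendstoL1loc {d : ℕ} (F : ℕ → Rd d → ℝ) (g : Rd d → ℝ) : Prop :=
  ∀ K : Set (Rd d), IsCompact K →
    Tendsto (fun N => ∫⁻ x in K, ‖F N x - g x‖ₑ) atTop (𝓝 0)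

/-- Membership of the class of `f` in `C^{0,α}(ℝ^d)`: some representative is bounded and uniformly
`α`-Hölder continuous on `ℝ^d`. -/
def MemHolder {d : ℕ} (α : ℝ) (f : Rd d → ℝ) : Prop :=
  ∃ u : Rd d → ℝ, u =ᵐ[volume] f ∧ (∃ M : ℝ, ∀ x, |u x| ≤ M) ∧
    ∃ C : ℝ, ∀ x y, |u x - u y| ≤ C * ‖x - y‖ ^ α

end DiscreteGradient

end

open scoped ENNReal

namespace DiscreteGradient

/-! ### Discrete Sobolev inequality on `ℤ^d` -/

section

theorem pi_count_int (d : ℕ) :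
    Measure.pi (fun _ : Fin d => (Measure.count : Measure ℤ)) = Measure.count := by
  refine Measure.ext_of_singleton fun k => ?_
  rw [Measure.pi_singleton]
  simp

/-- Telescope from `n` to `n + m` and let `m` go to infinity, where `φ` vanishes. -/
theorem enorm_le_tsum_enorm_sub {φ : ℤ → ℝ} (h : Tendsto φ cofinite (𝓝 0)) (n : ℤ) :
    ‖φ n‖ₑ ≤ ∑' t, ‖φ (t + 1) - φ t‖ₑ := by
  have hstep : ∀ m : ℕ, ‖φ n‖ₑ ≤
      ‖φ (n + m)‖ₑ + ∑ j ∈ Finset.range m, ‖φ (n + j + 1) - φ (n + j)‖ₑ := by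
    intro m
    induction m with
    | zero => simp
    | succ m ih =>
      refine ih.trans ?_
      rw [Finset.sum_range_succ, add_comm (∑ j ∈ _, _), ← add_assoc]
      gcongr
      have : φ (n + m) = φ (n + ↑(m + 1)) - (φ (n + m + 1) - φ (n + m)) := by
        push_cast; rw [← add_assoc]; ring
      calc ‖φ (n + m)‖ₑ = ‖φ (n + ↑(m + 1)) - (φ (n + m + 1) - φ (n + m))‖ₑ := by rw [← this]
        _ ≤ _ := enorm_sub_le
  have hinj : Function.Injective (fun j : ℕ => n + (j : ℤ)) := fun a b hab => by
    simpa using hab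
  have hle : ∀ m : ℕ, ‖φ n‖ₑ ≤ ‖φ (n + m)‖ₑ + ∑' t, ‖φ (t + 1) - φ t‖ₑ := by
    intro m
    refine (hstep m).trans ?_
    gcongr
    exact (ENNReal.sum_le_tsum _).trans
      (ENNReal.tsum_comp_le_tsum_of_injective hinj fun t => ‖φ (t + 1) - φ t‖ₑ)
  have hlim : Tendsto (fun m : ℕ => ‖φ (n + m)‖ₑ + ∑' t, ‖φ (t + 1) - φ t‖ₑ) atTop
      (𝓝 (0 + ∑' t, ‖φ (t + 1) - φ t‖ₑ)) := by
    refine Tendsto.add ?_ tendsto_const_nhds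
    have := (h.comp hinj.tendsto_cofinite).enorm
    rw [Nat.cofinite_eq_atTop] at this
    simpa using this
  rw [zero_add] at hlim
  exact ge_of_tendsto' hlim hle

theorem le_sum_apply {ι : Type*} [Fintype ι] (F : ι → ℝ≥0∞) (i : ι) : F i ≤ ∑ j, F j :=
  Finset.single_le_sum (fun _ _ => bot_le) (Finset.mem_univ i)

/-- The discrete Gagliardo-Nirenberg-Sobolev inequality for the exponent `1`. -/
theorem tsum_rpow_le_tsum_discreteGradient {d : ℕ} (hd : 1 < d) {w : (Fin d → ℤ) → ℝ}
    (hw : Tendsto w cofinite (𝓝 0)) :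
    ∑' k, ‖w k‖ₑ ^ ((d : ℝ) / (d - 1)) ≤
      (∑' k, ∑ i, ‖w (k + Pi.single i 1) - w k‖ₑ) ^ ((d : ℝ) / (d - 1)) := by
  have hd' : (1 : ℝ) < d := by exact_mod_cast hd
  set G : (Fin d → ℤ) → ℝ≥0∞ := fun k => ∑ i, ‖w (k + Pi.single i 1) - w k‖ₑ with hG
  have hpq : Real.HolderConjugate (Fintype.card (Fin d)) ((d : ℝ) / (d - 1)) := by
    rw [Fintype.card_fin]
    exact Real.HolderConjugate.conjExponent hd'
  -- The grid-lines inequality (of Loomis-Whitney type), read with counting measure on `ℤ^d`; it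
  -- remains to bound `‖w k‖` by the sum of `G` over each of the `d` axis lines through `k`.
  have key := lintegral_prod_lintegral_pow_le (μ := fun _ : Fin d => (Measure.count : Measure ℤ))
    hpq (f := G) (measurable_of_countable _)
  rw [pi_count_int, lintegral_count, lintegral_count] at key
  refine le_trans (ENNReal.tsum_le_tsum fun k => ?_) key
  have hline : ∀ i, ‖w k‖ₑ ≤ ∑' t, G (Function.update k i t) := by
    intro i
    have hinj : Function.Injective (fun t : ℤ => Function.update k i t) :=
      Function.update_injective k i
    have h1 := enorm_le_tsum_enorm_sub (hw.comp hinj.tendsto_cofinite) (k i)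
    simp only [Function.comp_def, Function.update_eq_self] at h1
    refine h1.trans (ENNReal.tsum_le_tsum fun t => ?_)
    have h2 : Function.update k i (t + 1) = Function.update k i t + Pi.single i 1 := by
      ext j
      by_cases hj : j = i
      · subst hj; simp
      · simp [hj]
    rw [h2]
    exact le_sum_apply _ i
  calc ‖w k‖ₑ ^ ((d : ℝ) / (d - 1))
      = ∏ _i : Fin d, ‖w k‖ₑ ^ ((1 : ℝ) / (d - 1)) := by
        rw [Finset.prod_const, Finset.card_univ, Fintype.card_fin, ← ENNReal.rpow_natCast,
          ← ENNReal.rpow_mul]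
        congr 1; ring
    _ ≤ _ := by
        refine Finset.prod_le_prod' fun i _ => ?_
        rw [lintegral_count, Fintype.card_fin]
        exact ENNReal.rpow_le_rpow (hline i) (by
          apply div_nonneg zero_le_one; linarith)

/-- Convexity of the power: for `b ≤ a`, Bernoulli's inequality at `b / a` puts the graph above its
tangent at `a`. -/
theorem abs_rpow_sub_rpow_le {a b γ : ℝ} (ha : 0 ≤ a) (hb : 0 ≤ b) (hγ : 1 ≤ γ) :
    |a ^ γ - b ^ γ| ≤ γ * ((a ^ (γ - 1) + b ^ (γ - 1)) * |a - b|) := by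
  wlog hab : b ≤ a generalizing a b
  · have := this hb ha (le_of_not_ge hab)
    rwa [abs_sub_comm, add_comm, abs_sub_comm a]
  have hpow : b ^ γ ≤ a ^ γ := Real.rpow_le_rpow hb hab (by linarith)
  rw [abs_of_nonneg (sub_nonneg.2 hpow), abs_of_nonneg (sub_nonneg.2 hab)]
  rcases ha.eq_or_lt with rfl | ha
  · obtain rfl : b = 0 := le_antisymm hab hb
    simp
  have h1 : 1 + γ * (b / a - 1) ≤ (1 + (b / a - 1)) ^ γ :=
    one_add_mul_self_le_rpow_one_add (by
      have : 0 ≤ b / a := by positivity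
      linarith) hγ
  rw [add_sub_cancel, Real.div_rpow hb ha.le] at h1
  have h2 : a ^ γ = a ^ (γ - 1) * a := by
    rw [← Real.rpow_add_one ha.ne']; simp
  have h3 : a ^ γ * (1 + γ * (b / a - 1)) ≤ b ^ γ := by
    have := mul_le_mul_of_nonneg_left h1 (Real.rpow_nonneg ha.le γ)
    rwa [mul_div_cancel₀ _ (Real.rpow_pos_of_pos ha γ).ne'] at this
  have h4 : a ^ γ * (1 + γ * (b / a - 1)) = a ^ γ - γ * (a ^ (γ - 1) * (a - b)) := by
    rw [h2]; field_simp; ring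
  have h5 : 0 ≤ γ * (b ^ (γ - 1) * (a - b)) := by
    have := sub_nonneg.2 hab
    positivity
  nlinarith [h3, h4, h5]

theorem one_lt_of_lt_cast {d : ℕ} {p : ℝ} (hp : 1 ≤ p) (hpd : p < d) : 1 < d := by
  exact_mod_cast hp.trans_lt hpd

theorem le_sobolevExp {d : ℕ} {p : ℝ} (hp : 1 ≤ p) (hpd : p < d) : p ≤ sobolevExp d p := by
  rw [sobolevExp, le_div_iff₀ (by linarith)]
  nlinarith

/-- Hölder with exponents `p' = p / (p - 1)` and `p`: the power of `v` is the one that `p'` turns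
into `p*`. -/
theorem tsum_rpow_mul_le_of_sobolevExp {ι : Type*} {d : ℕ} {p : ℝ} (hp : 1 ≤ p) (hpd : p < d)
    (v g : ι → ℝ≥0∞) :
    ∑' k, v k ^ (p * (d - 1) / (d - p) - 1) * g k ≤
      (∑' k, v k ^ sobolevExp d p) ^ ((p - 1) / p) * (∑' k, g k ^ p) ^ (1 / p) := by
  let _ : MeasurableSpace ι := ⊤
  have hdp : (0 : ℝ) < d - p := by linarith
  -- At `p = 1` there is no finite conjugate exponent, but both powers attached to `v` are `0`.
  rcases hp.eq_or_lt with rfl | hp1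
  · have : (1 : ℝ) * (d - 1) / (d - 1) - 1 = 0 := by field_simp; ring
    simp only [this]
    simp
  have hpq := (Real.HolderConjugate.conjExponent hp1).symm
  have := ENNReal.lintegral_mul_le_Lp_mul_Lq (Measure.count : Measure ι) hpq
    (f := fun k => v k ^ (p * (d - 1) / (d - p) - 1)) (g := g)
    (Measurable.of_discrete).aemeasurable (Measurable.of_discrete).aemeasurable
  simp only [lintegral_count, Pi.mul_apply, ← ENNReal.rpow_mul] at this
  refine this.trans_eq ?_
  have hp1' : p - 1 ≠ 0 := by linarith
  have e1 : (p * (d - 1) / (d - p) - 1) * p.conjExponent = sobolevExp d p := by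
    rw [Real.conjExponent, sobolevExp]; field_simp; ring
  have e2 : 1 / p.conjExponent = (p - 1) / p := by
    rw [Real.conjExponent]; field_simp
  rw [e1, e2]

/-- The terms of a `p`-summable family are bounded. This supplies the finite `p*`-sum that the
Sobolev inequality divides by. -/
theorem tsum_rpow_ne_top_of_le {ι : Type*} {p q : ℝ} (hp : 0 < p) (hpq : p ≤ q) {v : ι → ℝ≥0∞}
    (h : ∑' k, v k ^ p ≠ ∞) : ∑' k, v k ^ q ≠ ∞ := by
  set B := (∑' k, v k ^ p) ^ (1 / p)
  have hB : B ≠ ∞ := ENNReal.rpow_ne_top_of_nonneg (by positivity) h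
  have hv : ∀ k, v k ≤ B := fun k => by
    simp only [B]
    rw [one_div, ENNReal.le_rpow_inv_iff hp]
    exact ENNReal.le_tsum (f := fun k => v k ^ p) k
  have : ∑' k, v k ^ q ≤ ∑' k, B ^ (q - p) * v k ^ p := ENNReal.tsum_le_tsum fun k => by
    calc v k ^ q = v k ^ (q - p) * v k ^ p := by
          rw [← ENNReal.rpow_add_of_nonneg _ _ (sub_nonneg.2 hpq) hp.le, sub_add_cancel]
      _ ≤ _ := by gcongr; exact hv k
  rw [ENNReal.tsum_mul_left] at this
  exact ne_top_of_le_ne_top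
    (ENNReal.mul_ne_top (ENNReal.rpow_ne_top_of_nonneg (sub_nonneg.2 hpq) hB) h) this

/-- The discrete Gagliardo-Nirenberg-Sobolev inequality for `p`-summable functions on `ℤ^d`. -/
theorem tsum_sobolevExp_le_sum_discreteGradient {E : Type*} [NormedAddCommGroup E] {d : ℕ} {p : ℝ}
    (hp : 1 ≤ p) (hpd : p < d) {w : (Fin d → ℤ) → E} (hw : ∑' k, ‖w k‖ₑ ^ p ≠ ∞) :
    (∑' k, ‖w k‖ₑ ^ sobolevExp d p) ^ (1 / sobolevExp d p) ≤
      ENNReal.ofReal (2 * (p * (d - 1) / (d - p))) *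
        ∑ i, (∑' k, ‖w (k + Pi.single i 1) - w k‖ₑ ^ p) ^ (1 / p) := by
  have hp0 : 0 < p := by linarith
  have hdp : (0 : ℝ) < d - p := by linarith
  have hd1 : (0 : ℝ) < d - 1 := by linarith
  have hd0 : (0 : ℝ) < d := by linarith
  have hq0 : 0 < sobolevExp d p := hp0.trans_le (le_sobolevExp hp hpd)
  -- Chosen so that `γ d / (d - 1) = p*`: the case of exponent `1` is applied to `‖w‖ ^ γ`.
  set γ := p * (d - 1) / (d - p) with hγ
  have hγ1 : 1 ≤ γ := by
    rw [hγ, le_div_iff₀ hdp]; nlinarith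
  have hγ0 : 0 < γ := by linarith
  set S := ∑' k, ‖w k‖ₑ ^ sobolevExp d p with hS
  have hStop : S ≠ ∞ := tsum_rpow_ne_top_of_le hp0 (le_sobolevExp hp hpd) hw
  set D : Fin d → ℝ≥0∞ := fun i => (∑' k, ‖w (k + Pi.single i 1) - w k‖ₑ ^ p) ^ (1 / p) with hD
  have hw0 : Tendsto (fun k => ‖w k‖ ^ γ) cofinite (𝓝 0) := by
    have h1 : Tendsto (fun k => ‖w k‖ₑ ^ p) cofinite (𝓝 0) :=
      ENNReal.tendsto_cofinite_zero_of_tsum_ne_top hw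
    have h2 : Tendsto (fun k => (‖w k‖ₑ ^ p) ^ (1 / p)) cofinite (𝓝 (0 ^ (1 / p))) :=
      h1.ennrpow_const _
    have h3 : Tendsto (fun k => ‖w k‖ₑ) cofinite (𝓝 0) := by
      simpa [← ENNReal.rpow_mul, hp0.ne', hp0] using h2
    have h4 : Tendsto (fun k => ‖w k‖) cofinite (𝓝 0) := by
      have := (ENNReal.tendsto_toReal ENNReal.zero_ne_top).comp h3
      simpa [Function.comp_def] using this
    have h5 := h4.rpow_const (p := γ) (Or.inr hγ0.le)
    rwa [Real.zero_rpow hγ0.ne'] at h5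
  have hone := tsum_rpow_le_tsum_discreteGradient (one_lt_of_lt_cast hp hpd) hw0
  have he : ∀ k, ‖‖w k‖ ^ γ‖ₑ ^ ((d : ℝ) / (d - 1)) = ‖w k‖ₑ ^ sobolevExp d p := by
    intro k
    rw [Real.enorm_rpow_of_nonneg (norm_nonneg _) hγ0.le, enorm_norm, ← ENNReal.rpow_mul]
    congr 1
    rw [hγ, sobolevExp]; field_simp
  simp only [he] at hone
  have hone' : S ^ (((d : ℝ) - 1) / d) ≤
      ∑' k, ∑ i, ‖‖w (k + Pi.single i 1)‖ ^ γ - ‖w k‖ ^ γ‖ₑ := by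
    have := ENNReal.rpow_le_rpow hone (z := ((d : ℝ) - 1) / d) (by positivity)
    rw [← ENNReal.rpow_mul] at this
    rwa [show (d : ℝ) / (d - 1) * ((d - 1) / d) = 1 by field_simp, ENNReal.rpow_one] at this
  have hpt : ∀ k i, ‖‖w (k + Pi.single i 1)‖ ^ γ - ‖w k‖ ^ γ‖ₑ ≤
      ENNReal.ofReal γ * (‖w (k + Pi.single i 1)‖ₑ ^ (γ - 1) * ‖w (k + Pi.single i 1) - w k‖ₑ +
        ‖w k‖ₑ ^ (γ - 1) * ‖w (k + Pi.single i 1) - w k‖ₑ) := by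
    intro k i
    have h1 := abs_rpow_sub_rpow_le (norm_nonneg (w (k + Pi.single i 1))) (norm_nonneg (w k)) hγ1
    have h2 : |‖w (k + Pi.single i 1)‖ ^ γ - ‖w k‖ ^ γ| ≤
        γ * ((‖w (k + Pi.single i 1)‖ ^ (γ - 1) + ‖w k‖ ^ (γ - 1)) *
          ‖w (k + Pi.single i 1) - w k‖) :=
      h1.trans (by gcongr; exact abs_norm_sub_norm_le _ _)
    have h3 := ENNReal.ofReal_le_ofReal h2
    rw [← Real.enorm_eq_ofReal_abs, ENNReal.ofReal_mul hγ0.le, ENNReal.ofReal_mul (by positivity),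
      ENNReal.ofReal_add (by positivity) (by positivity),
      ← ENNReal.ofReal_rpow_of_nonneg (norm_nonneg _) (by linarith),
      ← ENNReal.ofReal_rpow_of_nonneg (norm_nonneg _) (by linarith), add_mul] at h3
    simpa only [ofReal_norm] using h3
  have hsum : ∑' k, ∑ i, ‖‖w (k + Pi.single i 1)‖ ^ γ - ‖w k‖ ^ γ‖ₑ ≤
      S ^ ((p - 1) / p) * (ENNReal.ofReal (2 * γ) * ∑ i, D i) := by
    rw [Summable.tsum_finsetSum fun _ _ => ENNReal.summable, Finset.mul_sum, Finset.mul_sum]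
    refine Finset.sum_le_sum fun i _ => ?_
    refine (ENNReal.tsum_le_tsum fun k => hpt k i).trans ?_
    rw [ENNReal.tsum_mul_left, ENNReal.tsum_add]
    have b1 := tsum_rpow_mul_le_of_sobolevExp hp hpd (fun k => ‖w k‖ₑ)
      (fun k => ‖w (k + Pi.single i 1) - w k‖ₑ)
    have b2 := tsum_rpow_mul_le_of_sobolevExp hp hpd (fun k => ‖w (k + Pi.single i 1)‖ₑ)
      (fun k => ‖w (k + Pi.single i 1) - w k‖ₑ)
    have hshift : ∑' k : Fin d → ℤ, ‖w (k + Pi.single i 1)‖ₑ ^ sobolevExp d p = S :=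
      (Equiv.addRight (Pi.single i (1 : ℤ))).tsum_eq fun k => ‖w k‖ₑ ^ sobolevExp d p
    rw [hshift] at b2
    refine (mul_le_mul_right (add_le_add b2 b1) _).trans_eq ?_
    rw [← two_mul, ENNReal.ofReal_mul zero_le_two, ENNReal.ofReal_ofNat]
    simp only [hD]
    ring
  rcases eq_or_ne S 0 with hS0 | hS0
  · rw [hS0, ENNReal.zero_rpow_of_pos (by positivity)]; exact zero_le
  have hfin := hone'.trans hsum
  -- The surplus factor `S ^ ((p - 1) / p)` stands on both sides and cancels, as `S` is neither `0`
  -- nor `∞`.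
  rw [show ((d : ℝ) - 1) / d = (p - 1) / p + 1 / sobolevExp d p by
      rw [sobolevExp]; field_simp; ring, ENNReal.rpow_add _ _ hS0 hStop] at hfin
  have hne0 : S ^ ((p - 1) / p) ≠ 0 := by
    simp [ENNReal.rpow_eq_zero_iff, hS0, hStop]
  have hnet : S ^ ((p - 1) / p) ≠ ∞ := by
    simp [ENNReal.rpow_eq_top_iff, hS0, hStop]
  exact (ENNReal.mul_le_mul_iff_right hne0 hnet).1 hfin

end

/-! ### Limit at infinity of Banach-valued functions on `ℤ^d` -/

section

/-- The basis vectors generate `ℤ^d` as a group. -/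
theorem addSubgroup_eq_top_of_single_mem {d : ℕ} (H : AddSubgroup (Fin d → ℤ))
    (h : ∀ i, Pi.single i (1 : ℤ) ∈ H) (k : Fin d → ℤ) : k ∈ H := by
  rw [← Finset.univ_sum_single k]
  refine sum_mem fun i _ => ?_
  have : (Pi.single i (k i) : Fin d → ℤ) = k i • Pi.single i 1 := by
    ext j; by_cases hj : j = i
    · subst hj; simp
    · simp [hj]
  rw [this]
  exact zsmul_mem (h i) _

section

variable {ι E : Type*} [NormedAddCommGroup E]

theorem tsum_enorm_add_rpow_le {p : ℝ} (hp : 1 ≤ p) (f g : ι → E) :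
    (∑' k, ‖f k + g k‖ₑ ^ p) ^ (1 / p) ≤
      (∑' k, ‖f k‖ₑ ^ p) ^ (1 / p) + (∑' k, ‖g k‖ₑ ^ p) ^ (1 / p) := by
  let _ : MeasurableSpace ι := ⊤
  have h := ENNReal.lintegral_Lp_add_le (μ := (Measure.count : Measure ι)) (p := p)
    (f := fun k => ‖f k‖ₑ) (g := fun k => ‖g k‖ₑ)
    (Measurable.of_discrete).aemeasurable (Measurable.of_discrete).aemeasurable hp
  simp only [lintegral_count, Pi.add_apply] at h
  refine le_trans ?_ h
  gcongr
  exact enorm_add_le _ _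

theorem tsum_enorm_add_rpow_ne_top {p : ℝ} (hp : 1 ≤ p) {f g : ι → E}
    (hf : ∑' k, ‖f k‖ₑ ^ p ≠ ∞) (hg : ∑' k, ‖g k‖ₑ ^ p ≠ ∞) :
    ∑' k, ‖f k + g k‖ₑ ^ p ≠ ∞ := by
  have hp0 : 0 < p := by linarith
  have hp1 : 0 < 1 / p := by positivity
  have h := tsum_enorm_add_rpow_le hp f g
  have : (∑' k, ‖f k + g k‖ₑ ^ p) ^ (1 / p) ≠ ∞ := ne_top_of_le_ne_top
    (ENNReal.add_ne_top.2 ⟨ENNReal.rpow_ne_top_of_nonneg hp1.le hf,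
      ENNReal.rpow_ne_top_of_nonneg hp1.le hg⟩) h
  intro htop
  exact this (by rw [htop, ENNReal.top_rpow_of_pos hp1])

theorem tendsto_cofinite_zero_of_tsum_enorm_rpow_ne_top {p : ℝ} (hp : 0 < p) {f : ι → E}
    (hf : ∑' k, ‖f k‖ₑ ^ p ≠ ∞) : Tendsto f cofinite (𝓝 0) := by
  have h1 : Tendsto (fun k => ‖f k‖ₑ ^ p) cofinite (𝓝 0) :=
    ENNReal.tendsto_cofinite_zero_of_tsum_ne_top hf
  have h2 : Tendsto (fun k => (‖f k‖ₑ ^ p) ^ (1 / p)) cofinite (𝓝 (0 ^ (1 / p))) :=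
    h1.ennrpow_const _
  rw [tendsto_zero_iff_norm_tendsto_zero]
  have h3 : Tendsto (fun k => ‖f k‖ₑ) cofinite (𝓝 0) := by
    simpa [← ENNReal.rpow_mul, hp.ne', hp] using h2
  simpa [Function.comp_def] using (ENNReal.tendsto_toReal ENNReal.zero_ne_top).comp h3

end

variable {E : Type*} [NormedAddCommGroup E] {d : ℕ} {p : ℝ}

/-- By Minkowski and shift invariance, the admissible `m` form a subgroup, and it contains the basis
vectors. -/
theorem tsum_enorm_shift_sub_rpow_ne_top (hp : 1 ≤ p) {u : (Fin d → ℤ) → E}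
    (hu : ∀ i, ∑' k, ‖u (k + Pi.single i 1) - u k‖ₑ ^ p ≠ ∞) (m : Fin d → ℤ) :
    ∑' k, ‖u (k + m) - u k‖ₑ ^ p ≠ ∞ := by
  have hp0 : 0 < p := by linarith
  have hshift : ∀ a : Fin d → ℤ, ∀ g : (Fin d → ℤ) → ℝ≥0∞, ∑' k, g (k + a) = ∑' k, g k :=
    fun a g => (Equiv.addRight a).tsum_eq g
  let H : AddSubgroup (Fin d → ℤ) :=
    { carrier := {m | ∑' k, ‖u (k + m) - u k‖ₑ ^ p ≠ ∞}
      zero_mem' := by simp [hp0]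
      add_mem' := by
        intro a b ha hb
        have h1 : ∑' k, ‖u (k + a + b) - u (k + a)‖ₑ ^ p ≠ ∞ := by
          rw [hshift a fun k => ‖u (k + b) - u k‖ₑ ^ p]
          exact hb
        have := tsum_enorm_add_rpow_ne_top hp h1 ha
        simpa [← add_assoc] using this
      neg_mem' := by
        intro a ha
        have h1 := hshift a fun k => ‖u (k + -a) - u k‖ₑ ^ p
        simp only [add_neg_cancel_right] at h1
        simp only [Set.mem_ofPred_eq] at ha ⊢
        rw [← h1]
        simpa only [← edist_eq_enorm_sub, edist_comm] using ha }
  exact addSubgroup_eq_top_of_single_mem H hu m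

/-- The translation differences of a function on `ℤ^d` with `p`-summable discrete gradient are
bounded in `ℓ^{p*}` uniformly in the translation. -/
theorem tsum_enorm_shift_sub_le (hp : 1 ≤ p) (hpd : p < d) {u : (Fin d → ℤ) → E}
    (hu : ∀ i, ∑' k, ‖u (k + Pi.single i 1) - u k‖ₑ ^ p ≠ ∞) :
    ∃ K : ℝ≥0∞, K ≠ ∞ ∧ ∀ m, ∑' k, ‖u (k + m) - u k‖ₑ ^ sobolevExp d p ≤ K := by
  have hp0 : 0 < p := by linarith
  have hq0 : 0 < sobolevExp d p := hp0.trans_le (le_sobolevExp hp hpd)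
  have hshift : ∀ a : Fin d → ℤ, ∀ g : (Fin d → ℤ) → ℝ≥0∞, ∑' k, g (k + a) = ∑' k, g k :=
    fun a g => (Equiv.addRight a).tsum_eq g
  -- The Sobolev bound with each gradient norm doubled: the gradient of `u(· + m) - u` is the
  -- difference of two translates of the gradient of `u`.
  refine ⟨(ENNReal.ofReal (2 * (p * (d - 1) / (d - p))) *
    ∑ i, (2 * (∑' k, ‖u (k + Pi.single i 1) - u k‖ₑ ^ p) ^ (1 / p))) ^ sobolevExp d p, ?_, ?_⟩
  · refine ENNReal.rpow_ne_top_of_nonneg hq0.le (ENNReal.mul_ne_top ENNReal.ofReal_ne_top ?_)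
    refine ENNReal.sum_ne_top.2 fun i _ => ENNReal.mul_ne_top (by simp) ?_
    exact ENNReal.rpow_ne_top_of_nonneg (by positivity) (hu i)
  intro m
  have h := tsum_sobolevExp_le_sum_discreteGradient hp hpd
    (tsum_enorm_shift_sub_rpow_ne_top hp hu m)
  rw [one_div, ENNReal.rpow_inv_le_iff hq0] at h
  refine h.trans ?_
  gcongr with i
  have h1 := tsum_enorm_add_rpow_le hp (fun k => u (k + m + Pi.single i 1) - u (k + m))
    (fun k => -(u (k + Pi.single i 1) - u k))
  simp only [enorm_neg] at h1
  have h2 : ∑' k, ‖u (k + m + Pi.single i 1) - u (k + m)‖ₑ ^ p =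
      ∑' k, ‖u (k + Pi.single i 1) - u k‖ₑ ^ p :=
    hshift m fun k => ‖u (k + Pi.single i 1) - u k‖ₑ ^ p
  rw [h2, ← two_mul] at h1
  refine le_trans (le_of_eq ?_) h1
  congr 3
  ext k
  congr 2
  rw [add_right_comm]
  abel

/-- A function on `ℤ^d` with values in a Banach space and `p`-summable discrete gradient differs
from some constant by a `p*`-summable function. -/
theorem exists_tsum_enorm_sub_ne_top [CompleteSpace E] (hp : 1 ≤ p) (hpd : p < d)
    {u : (Fin d → ℤ) → E} (hu : ∀ i, ∑' k, ‖u (k + Pi.single i 1) - u k‖ₑ ^ p ≠ ∞) :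
    ∃ c, ∑' k, ‖u k - c‖ₑ ^ sobolevExp d p ≠ ∞ := by
  have hp0 : 0 < p := by linarith
  set q := sobolevExp d p with hq
  have hq0 : 0 < q := hp0.trans_le (le_sobolevExp hp hpd)
  have : Nonempty (Fin d) := ⟨⟨0, by have := one_lt_of_lt_cast hp hpd; omega⟩⟩
  obtain ⟨K, hK, hKu⟩ := tsum_enorm_shift_sub_le hp hpd hu
  have hKab : ∀ (T : Finset (Fin d → ℤ)) (a b : Fin d → ℤ),
      ∑ x ∈ T, ‖u (x + a) - u (x + b)‖ₑ ^ q ≤ K := by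
    intro T a b
    refine (ENNReal.sum_le_tsum T).trans ?_
    have h1 := (Equiv.addRight b).tsum_eq fun k => ‖u (k + (a - b)) - u k‖ₑ ^ q
    have h2 : ∀ x, x + b + (a - b) = x + a := fun x => by abel
    simp only [Equiv.coe_addRight, h2] at h1
    rw [h1]
    exact hKu _
  have hflat : ∀ x, Tendsto (fun a => u (x + a) - u a) cofinite (𝓝 0) := by
    intro x
    simp only [add_comm x]
    exact tendsto_cofinite_zero_of_tsum_enorm_rpow_ne_top hp0
      (tsum_enorm_shift_sub_rpow_ne_top hp hu x)
  have hcauchy : Cauchy (map u cofinite) := by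
    rw [Metric.cauchy_iff]
    refine ⟨inferInstance, fun ε hε => ?_⟩
    -- With `n` points `x`, gaps of at least `ε / 2` between `u (x + a)` and `u (x + b)` already
    -- exceed the uniform bound `K`.
    obtain ⟨n, hn⟩ := ENNReal.exists_nat_mul_gt (a := ENNReal.ofReal (ε / 2) ^ q) (b := K)
      (by simp [ENNReal.rpow_eq_zero_iff, hε, hq0.not_gt]) hK
    obtain ⟨T, hT⟩ := Infinite.exists_subset_card_eq (Fin d → ℤ) n
    have hev : ∀ᶠ a in cofinite, ∀ x ∈ T, ‖u (x + a) - u a‖ < ε / 4 := by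
      rw [eventually_all_finset]
      intro x _
      have := (hflat x).norm
      rw [norm_zero] at this
      exact this.eventually_lt_const (by positivity)
    refine ⟨u '' {a | ∀ x ∈ T, ‖u (x + a) - u a‖ < ε / 4}, image_mem_map hev, ?_⟩
    rintro _ ⟨a, ha, rfl⟩ _ ⟨b, hb, rfl⟩
    by_contra hab
    rw [not_lt, dist_eq_norm] at hab
    have hx : ∀ x ∈ T, ENNReal.ofReal (ε / 2) ^ q ≤ ‖u (x + a) - u (x + b)‖ₑ ^ q := by
      intro x hx
      refine ENNReal.rpow_le_rpow ?_ hq0.le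
      rw [← ofReal_norm]
      refine ENNReal.ofReal_le_ofReal ?_
      have h1 := ha x hx
      have h2 := hb x hx
      have h3 : u a - u b = (u (x + a) - u (x + b)) - (u (x + a) - u a) + (u (x + b) - u b) := by
        abel
      have h4 : ‖u a - u b‖ ≤
          ‖u (x + a) - u (x + b)‖ + ‖u (x + a) - u a‖ + ‖u (x + b) - u b‖ := by
        conv_lhs => rw [h3]
        exact (norm_add_le _ _).trans (by gcongr; exact norm_sub_le _ _)
      linarith
    have := (Finset.sum_le_sum hx).trans (hKab T a b)
    rw [Finset.sum_const, hT, nsmul_eq_mul] at this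
    exact absurd hn this.not_gt
  obtain ⟨c, hc⟩ := CompleteSpace.complete hcauchy
  have hc : Tendsto u cofinite (𝓝 c) := hc
  refine ⟨c, ne_top_of_le_ne_top hK (ENNReal.summable.tsum_le_of_sum_le fun T => ?_)⟩
  -- On a finite set of points, the second translate is sent to infinity, where `u` tends to `c`;
  -- the bound `K` survives.
  have hlim : Tendsto (fun m => ∑ x ∈ T, ‖u (x + 0) - u (x + m)‖ₑ ^ q) cofinite
      (𝓝 (∑ x ∈ T, ‖u x - c‖ₑ ^ q)) := by
    refine tendsto_finsetSum _ fun x _ => ?_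
    rw [add_zero]
    have hinj : Function.Injective (fun m => x + m) := add_right_injective x
    exact ((tendsto_const_nhds.sub (hc.comp hinj.tendsto_cofinite)).enorm).ennrpow_const _
  exact le_of_tendsto' hlim fun m => hKab T 0 m

end

/-! ### Unit boxes, periodic extension and the limit of translates -/

section

variable {d : ℕ}

theorem latticePoint_apply (k : Fin d → ℤ) (i : Fin d) : latticePoint k i = k i := rfl

theorem latticePoint_add (k l : Fin d → ℤ) :
    latticePoint (k + l) = latticePoint k + latticePoint l := by
  ext i; simp [latticePoint_apply]

theorem latticePoint_neg (k : Fin d → ℤ) : latticePoint (-k) = -latticePoint k := by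
  ext i; simp [latticePoint_apply]

theorem latticePoint_zero : latticePoint (0 : Fin d → ℤ) = 0 := by
  ext i; simp [latticePoint_apply]

theorem latticePoint_single (i : Fin d) :
    latticePoint (Pi.single i 1 : Fin d → ℤ) = basisVec i := by
  ext j
  by_cases h : j = i
  · subst h; simp [latticePoint_apply, basisVec]
  · simp [latticePoint_apply, basisVec, h]

/-- The point of `ℤ^d` whose coordinates are the integer parts of those of `x`. -/
noncomputable def floorPt (x : Rd d) : Fin d → ℤ := fun i => ⌊x i⌋

/-- The half-open unit cube with lower corner `k`. -/
noncomputable def box (k : Fin d → ℤ) : Set (Rd d) := {x | floorPt x = k}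

theorem mem_box {k : Fin d → ℤ} {x : Rd d} : x ∈ box k ↔ floorPt x = k := Iff.rfl

theorem floorPt_add_latticePoint (x : Rd d) (k : Fin d → ℤ) :
    floorPt (x + latticePoint k) = floorPt x + k := by
  ext i; simp [floorPt, latticePoint_apply]

theorem measurable_floorPt : Measurable (floorPt : Rd d → Fin d → ℤ) :=
  measurable_pi_lambda _ fun i => Int.measurable_floor.comp
    (EuclideanSpace.proj (𝕜 := ℝ) i).continuous.measurable

theorem measurableSet_box (k : Fin d → ℤ) : MeasurableSet (box k) :=
  measurable_floorPt (measurableSet_singleton k)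

theorem preimage_add_latticePoint_box (j k : Fin d → ℤ) :
    (fun x => x + latticePoint k) ⁻¹' box (j + k) = box j := by
  ext x
  simp [mem_box, floorPt_add_latticePoint]

theorem volume_box_zero : volume (box (0 : Fin d → ℤ)) = 1 := by
  have h : box (0 : Fin d → ℤ) = (WithLp.ofLp : Rd d → Fin d → ℝ) ⁻¹'
      Set.univ.pi fun _ => Set.Ico 0 1 := by
    ext x
    simp [mem_box, funext_iff, floorPt, Int.floor_eq_zero_iff]
  rw [h, (PiLp.volume_preserving_ofLp (Fin d)).measure_preimage
    (MeasurableSet.univ_pi fun _ => measurableSet_Ico).nullMeasurableSet, volume_pi_pi]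
  simp

instance : IsProbabilityMeasure (volume.restrict (box (0 : Fin d → ℤ))) :=
  ⟨by simp [volume_box_zero]⟩

theorem setLIntegral_box_add (j k : Fin d → ℤ) (g : Rd d → ℝ≥0∞) :
    ∫⁻ x in box (j + k), g x = ∫⁻ x in box j, g (x + latticePoint k) := by
  rw [← (measurePreserving_add_right volume (latticePoint k)).setLIntegral_comp_preimage_emb
    (measurableEmbedding_addRight _), preimage_add_latticePoint_box]

theorem setLIntegral_box (k : Fin d → ℤ) (g : Rd d → ℝ≥0∞) :
    ∫⁻ x in box k, g x = ∫⁻ x in box 0, g (x + latticePoint k) := by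
  rw [← setLIntegral_box_add, zero_add]

theorem iUnion_box : ⋃ k : Fin d → ℤ, box k = Set.univ :=
  Set.eq_univ_of_forall fun x => Set.mem_iUnion.2 ⟨floorPt x, rfl⟩

theorem lintegral_eq_tsum_box (g : Rd d → ℝ≥0∞) :
    ∫⁻ x, g x = ∑' k, ∫⁻ x in box k, g x := by
  rw [← setLIntegral_univ, ← iUnion_box, lintegral_iUnion measurableSet_box]
  intro j k hjk
  exact Set.disjoint_left.2 fun x hj hk => hjk ((mem_box.1 hj).symm.trans (mem_box.1 hk))

theorem setLIntegral_biUnion_finset_le {ι : Type*} (J : Finset ι) (s : ι → Set (Rd d))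
    (g : Rd d → ℝ≥0∞) : ∫⁻ x in ⋃ j ∈ J, s j, g x ≤ ∑ j ∈ J, ∫⁻ x in s j, g x := by
  classical
  induction J using Finset.induction_on with
  | empty => simp
  | insert j J hj ih =>
    rw [Finset.set_biUnion_insert, Finset.sum_insert hj]
    exact (lintegral_union_le _ _ _).trans (by gcongr)

theorem integrableOn_box {f : Rd d → ℝ} (hf : LocallyIntegrable f volume) (k : Fin d → ℤ) :
    IntegrableOn f (box k) := by
  have hK : IsCompact ((WithLp.toLp 2 : (Fin d → ℝ) → Rd d) ''
      Set.Icc (fun i => (k i : ℝ)) (fun i => (k i : ℝ) + 1)) :=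
    isCompact_Icc.image (PiLp.continuous_toLp 2 _)
  refine (hf.integrableOn_isCompact hK).mono_set fun x hx => ⟨x.ofLp, ?_, rfl⟩
  rw [mem_box] at hx
  subst hx
  exact ⟨fun i => Int.floor_le _, fun i => (Int.lt_floor_add_one _).le⟩

theorem exists_finset_subset_iUnion_box {K : Set (Rd d)} (hK : IsCompact K) :
    ∃ J : Finset (Fin d → ℤ), K ⊆ ⋃ k ∈ J, box k := by
  obtain ⟨R, hR⟩ := hK.isBounded.subset_closedBall 0
  refine ⟨Fintype.piFinset fun _ => Finset.Icc ⌊-R⌋ ⌊R⌋, fun x hx => ?_⟩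
  have hx' : ‖x‖ ≤ R := by simpa using hR hx
  simp only [Set.mem_iUnion]
  refine ⟨floorPt x, ?_, rfl⟩
  rw [Fintype.mem_piFinset]
  intro i
  have h1 : |x i| ≤ R := (PiLp.norm_apply_le x i).trans hx'
  rw [abs_le] at h1
  exact Finset.mem_Icc.2 ⟨Int.floor_le_floor h1.1, Int.floor_le_floor h1.2⟩

theorem locallyIntegrable_of_integrableOn_box {f : Rd d → ℝ}
    (hf : ∀ k, IntegrableOn f (box k)) : LocallyIntegrable f volume := by
  rw [locallyIntegrable_iff]
  intro K hK
  obtain ⟨J, hJ⟩ := exists_finset_subset_iUnion_box hK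
  exact (integrableOn_finset_iUnion.2 fun k _ => hf k).mono_set hJ

theorem integrableOn_box_comp_add_iff {f : Rd d → ℝ} (k : Fin d → ℤ) :
    IntegrableOn (fun x => f (x + latticePoint k)) (box 0) ↔ IntegrableOn f (box k) := by
  have h := (measurePreserving_add_right volume (latticePoint k)).integrableOn_comp_preimage
    (measurableEmbedding_addRight _) (f := f) (s := box (0 + k))
  rwa [preimage_add_latticePoint_box, zero_add] at h

/-- The extension by periodicity of the restriction of `c` to the unit cube. -/
noncomputable def periodicExt (c : Rd d → ℝ) : Rd d → ℝ := fun x => c (x - latticePoint (floorPt x))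

theorem periodicExt_add_latticePoint (c : Rd d → ℝ) (x : Rd d) (k : Fin d → ℤ) :
    periodicExt c (x + latticePoint k) = periodicExt c x := by
  simp [periodicExt, floorPt_add_latticePoint, latticePoint_add]

theorem periodicExt_of_mem_box_zero (c : Rd d → ℝ) {x : Rd d} (hx : x ∈ box 0) :
    periodicExt c x = c x := by
  rw [mem_box] at hx
  simp [periodicExt, hx, latticePoint_zero]

theorem isQPeriodic_periodicExt (c : Rd d → ℝ) : IsQPeriodic (periodicExt c) := fun i =>
  Eventually.of_forall fun x => by rw [← latticePoint_single, periodicExt_add_latticePoint]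

theorem measurable_periodicExt {c : Rd d → ℝ} (hc : Measurable c) : Measurable (periodicExt c) :=
  hc.comp (measurable_id.sub
    ((measurable_of_countable (latticePoint : (Fin d → ℤ) → Rd d)).comp measurable_floorPt))

theorem locallyIntegrable_periodicExt {c : Rd d → ℝ} (hc : IntegrableOn c (box 0)) :
    LocallyIntegrable (periodicExt c) volume := by
  refine locallyIntegrable_of_integrableOn_box fun k => ?_
  rw [← integrableOn_box_comp_add_iff]
  simp only [periodicExt_add_latticePoint]
  exact hc.congr_fun (fun x hx => (periodicExt_of_mem_box_zero c hx).symm) (measurableSet_box 0)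

/-- The unit box is a probability space, so the `L^1` norm there is at most the `L^p` norm; summing
over boxes gives the integral over `ℝ^d`. -/
theorem tsum_setLIntegral_delta_rpow_ne_top {p : ℝ} (hp : 1 ≤ p) {f : Rd d → ℝ} {i : Fin d}
    (hf : MemLp (delta i f) (ENNReal.ofReal p) volume) :
    ∑' k, (∫⁻ x in box 0, ‖f (x + latticePoint (k + Pi.single i 1)) -
      f (x + latticePoint k)‖ₑ) ^ p ≠ ∞ := by
  have hp0 : 0 < p := by linarith
  have hfin : ∫⁻ x, ‖delta i f x‖ₑ ^ p ≠ ∞ := by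
    have := lintegral_rpow_enorm_lt_top_of_eLpNorm_lt_top (by simpa using hp0)
      ENNReal.ofReal_ne_top hf.2
    rw [ENNReal.toReal_ofReal hp0.le] at this
    exact this.ne
  rw [lintegral_eq_tsum_box] at hfin
  refine ne_top_of_le_ne_top hfin (ENNReal.tsum_le_tsum fun k => ?_)
  rw [setLIntegral_box (g := fun x => ‖delta i f x‖ₑ ^ p)]
  have hm : AEStronglyMeasurable (fun x => delta i f (x + latticePoint k))
      (volume.restrict (box 0)) :=
    (hf.1.comp_quasiMeasurePreserving
      (measurePreserving_add_right volume (latticePoint k)).quasiMeasurePreserving).restrict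
  have h := eLpNorm_le_eLpNorm_of_exponent_le (p := 1) (q := ENNReal.ofReal p)
    (by simpa using hp) hm
  rw [eLpNorm_one_eq_lintegral_enorm, eLpNorm_eq_lintegral_rpow_enorm_toReal (by simpa using hp0)
    ENNReal.ofReal_ne_top, ENNReal.toReal_ofReal hp0.le, one_div, ENNReal.le_rpow_inv_iff hp0] at h
  refine le_trans (le_of_eq ?_) h
  simp only [delta, latticePoint_add, latticePoint_single, add_assoc]

/-- The translates by `ℤ^d` of a function with discrete gradient in `L^p` converge at infinity,
in `L^1` of the unit cube and at a `p*`-summable rate. -/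
theorem exists_translation_limit {p : ℝ} (hp : 1 ≤ p) (hpd : p < d) {f : Rd d → ℝ}
    (hf : MemBoldA p f) :
    ∃ c : Rd d → ℝ, Measurable c ∧ IntegrableOn c (box 0) ∧
      ∑' k, (∫⁻ x in box 0, ‖f (x + latticePoint k) - c x‖ₑ) ^ sobolevExp d p ≠ ∞ := by
  have hmem : ∀ k, MemLp (fun x => f (x + latticePoint k)) 1 (volume.restrict (box 0)) := fun k =>
    memLp_one_iff_integrable.2 ((integrableOn_box_comp_add_iff k).2 (integrableOn_box hf.1 k))
  let u : (Fin d → ℤ) → Lp ℝ 1 (volume.restrict (box (0 : Fin d → ℤ))) := fun k => (hmem k).toLp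
  obtain ⟨c, hc⟩ := exists_tsum_enorm_sub_ne_top hp hpd (u := u) fun i => by
    have h := tsum_setLIntegral_delta_rpow_ne_top hp (hf.2 i)
    convert h using 4 with k
    rw [← MemLp.toLp_sub, Lp.enorm_toLp, eLpNorm_one_eq_lintegral_enorm]
    rfl
  refine ⟨c, (Lp.stronglyMeasurable c).measurable, memLp_one_iff_integrable.1 (Lp.memLp c), ?_⟩
  convert hc using 4 with k
  conv_rhs => rw [← Lp.toLp_coeFn c (Lp.memLp c)]
  rw [← MemLp.toLp_sub, Lp.enorm_toLp, eLpNorm_one_eq_lintegral_enorm]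
  rfl

end

/-! ### Cell averages and uniqueness -/

section

variable {d : ℕ}

theorem isOpen_setOf_mem_cell : IsOpen {y : Rd d × Rd d | y.2 ∈ cell y.1} := by
  have : {y : Rd d × Rd d | y.2 ∈ cell y.1} =
      ⋂ i, {y : Rd d × Rd d | y.1 i < y.2 i} ∩ {y : Rd d × Rd d | y.2 i < y.1 i + 1} := by
    ext y; simp [cell]
  rw [this]
  exact isOpen_iInter_of_finite fun i =>
    (isOpen_lt (by fun_prop) (by fun_prop)).inter (isOpen_lt (by fun_prop) (by fun_prop))

theorem isOpen_cell (z : Rd d) : IsOpen (cell z) :=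
  isOpen_setOf_mem_cell.preimage (Continuous.prodMk_right z)

/-- Passes from cells with arbitrary corner to at most `2 ^ d` lattice boxes. -/
theorem cell_subset_iUnion_box (z : Rd d) :
    cell z ⊆ ⋃ ε ∈ Fintype.piFinset fun _ : Fin d => ({0, 1} : Finset ℤ),
      box (floorPt z + ε) := by
  intro x hx
  simp only [Set.mem_iUnion]
  refine ⟨floorPt x - floorPt z, ?_, by simp [mem_box]⟩
  rw [Fintype.mem_piFinset]
  intro i
  have h1 := Int.floor_le_floor (hx i).1.le
  have h2 := Int.floor_le_floor (hx i).2.le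
  rw [Int.floor_add_one] at h2
  simp only [floorPt, Pi.sub_apply, Finset.mem_insert, Finset.mem_singleton]
  omega

theorem integrableOn_cell {h : Rd d → ℝ} (hh : LocallyIntegrable h volume) (z : Rd d) :
    IntegrableOn h (cell z) :=
  (integrableOn_finset_iUnion.2 fun _ _ => integrableOn_box hh _).mono_set
    (cell_subset_iUnion_box z)

theorem enorm_localAvg_abs {h : Rd d → ℝ} (hh : LocallyIntegrable h volume) (z : Rd d) :
    ‖localAvg (fun x => |h x|) z‖ₑ = ∫⁻ x in cell z, ‖h x‖ₑ := by
  rw [← ofReal_integral_norm_eq_lintegral_enorm (integrableOn_cell hh z), localAvg,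
    Real.enorm_eq_ofReal (integral_nonneg fun _ => abs_nonneg _)]
  rfl

theorem stronglyMeasurable_localAvg {g : Rd d → ℝ} (hg : AEStronglyMeasurable g volume) :
    StronglyMeasurable (localAvg g) := by
  have h1 : localAvg g = fun z => ∫ x, {y : Rd d × Rd d | y.2 ∈ cell y.1}.indicator
      (fun y => hg.mk g y.2) (z, x) := by
    ext z
    rw [localAvg, integral_congr_ae (ae_restrict_of_ae hg.ae_eq_mk),
      ← integral_indicator (isOpen_cell z).measurableSet]
    rfl
  rw [h1]
  exact ((hg.stronglyMeasurable_mk.comp_measurable measurable_snd).indicator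
    isOpen_setOf_mem_cell.measurableSet).integral_prod_right'

/-- These step functions, constant on boxes, are the majorants of the local average in
`memLp_localAvg_abs`. -/
theorem memLp_comp_floorPt {q : ℝ} (hq : 0 < q) {a : (Fin d → ℤ) → ℝ≥0∞}
    (ha : ∑' k, a k ^ q ≠ ∞) (ε : Fin d → ℤ) :
    MemLp (fun z : Rd d => (a (floorPt z + ε)).toReal) (ENNReal.ofReal q) volume := by
  have hmeas : Measurable fun z : Rd d => (a (floorPt z + ε)).toReal :=
    (measurable_of_countable fun k => (a (k + ε)).toReal).comp measurable_floorPt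
  refine ⟨hmeas.aestronglyMeasurable, ?_⟩
  rw [eLpNorm_lt_top_iff_lintegral_rpow_enorm_lt_top (by simpa using hq) ENNReal.ofReal_ne_top,
    ENNReal.toReal_ofReal hq.le, lintegral_eq_tsum_box]
  refine lt_of_le_of_lt (ENNReal.tsum_le_tsum fun k => ?_)
    (((Equiv.addRight ε).tsum_eq fun k => a k ^ q).trans_lt ha.lt_top)
  rw [setLIntegral_box (g := fun z => ‖(a (floorPt z + ε)).toReal‖ₑ ^ q)]
  calc ∫⁻ z in box 0, ‖(a (floorPt (z + latticePoint k) + ε)).toReal‖ₑ ^ q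
      ≤ ∫⁻ z in box 0, a (k + ε) ^ q := by
        refine setLIntegral_mono' (measurableSet_box 0) fun z hz => ?_
        rw [floorPt_add_latticePoint, mem_box.1 hz, zero_add]
        gcongr
        rw [Real.enorm_of_nonneg ENNReal.toReal_nonneg]
        exact ENNReal.ofReal_toReal_le
    _ = a (k + ε) ^ q := by simp

theorem memLp_localAvg_abs {q : ℝ} (hq : 0 < q) {h : Rd d → ℝ} (hh : LocallyIntegrable h volume)
    (hsum : ∑' k, (∫⁻ x in box k, ‖h x‖ₑ) ^ q ≠ ∞) :
    MemLp (localAvg fun x => |h x|) (ENNReal.ofReal q) volume := by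
  refine (memLp_finsetSum (Fintype.piFinset fun _ : Fin d => ({0, 1} : Finset ℤ))
    fun ε _ => memLp_comp_floorPt hq hsum ε).mono
    (stronglyMeasurable_localAvg hh.aestronglyMeasurable.norm).aestronglyMeasurable
    (Eventually.of_forall fun z => ?_)
  have hfin : ∀ k, ∫⁻ x in box k, ‖h x‖ₑ ≠ ∞ := fun k => (integrableOn_box hh k).2.ne
  rw [← enorm_le_iff_norm_le, enorm_localAvg_abs hh,
    Real.enorm_of_nonneg (Finset.sum_nonneg fun _ _ => ENNReal.toReal_nonneg),
    ← ENNReal.toReal_sum fun _ _ => hfin _,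
    ENNReal.ofReal_toReal (ENNReal.sum_ne_top.2 fun _ _ => hfin _)]
  exact (lintegral_mono_set (cell_subset_iUnion_box z)).trans
    (setLIntegral_biUnion_finset_le _ _ _)

theorem ae_add_latticePoint_eq {h : Rd d → ℝ} (hh : IsQPeriodic h) (k : Fin d → ℤ) :
    ∀ᵐ x ∂(volume : Measure (Rd d)), h (x + latticePoint k) = h x := by
  have hshift : ∀ (a : Rd d) {P : Rd d → Prop}, (∀ᵐ x ∂(volume : Measure (Rd d)), P x) →
      ∀ᵐ x ∂(volume : Measure (Rd d)), P (x + a) := fun a _ hP =>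
    (measurePreserving_add_right volume a).quasiMeasurePreserving.ae hP
  let H : AddSubgroup (Fin d → ℤ) :=
    { carrier := {k | ∀ᵐ x ∂(volume : Measure (Rd d)), h (x + latticePoint k) = h x}
      zero_mem' := by simp [latticePoint_zero]
      add_mem' := by
        intro k l hk hl
        have h1 := hshift (latticePoint k) hl
        filter_upwards [hk, h1] with x hx1 hx2
        rw [latticePoint_add, ← add_assoc, hx2, hx1]
      neg_mem' := by
        intro k hk
        have h1 := hshift (latticePoint (-k)) hk
        filter_upwards [h1] with x hx
        rw [← hx, latticePoint_neg, neg_add_cancel_right] }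
  refine addSubgroup_eq_top_of_single_mem H (fun i => ?_) k
  have := hh i
  rw [← latticePoint_single] at this
  exact this

theorem preimage_add_cell (z a : Rd d) : (fun x => x + a) ⁻¹' cell (z + a) = cell z := by
  ext x
  simp only [cell, Set.mem_preimage, Set.mem_ofPred_eq, PiLp.add_apply]
  refine forall_congr' fun i => ?_
  constructor <;> rintro ⟨h1, h2⟩ <;> constructor <;> linarith

theorem setLIntegral_cell_add_latticePoint {h : Rd d → ℝ} (hh : IsQPeriodic h) (z : Rd d)
    (k : Fin d → ℤ) :
    ∫⁻ x in cell (z + latticePoint k), ‖h x‖ₑ = ∫⁻ x in cell z, ‖h x‖ₑ := by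
  rw [← (measurePreserving_add_right volume (latticePoint k)).setLIntegral_comp_preimage_emb
    (measurableEmbedding_addRight _), preimage_add_cell]
  refine lintegral_congr_ae (ae_restrict_of_ae ?_)
  filter_upwards [ae_add_latticePoint_eq hh k] with x hx
  rw [hx]

/-- All the boxes carry the same integral and there are infinitely many of them, since `d ≠ 0`. -/
theorem ae_eq_zero_of_lintegral_ne_top {φ : Rd d → ℝ≥0∞} [NeZero d] (hm : AEMeasurable φ volume)
    (hφ : ∀ z k, φ (z + latticePoint k) = φ z) (hfin : ∫⁻ z, φ z ≠ ∞) :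
    φ =ᵐ[volume] 0 := by
  rw [← lintegral_eq_zero_iff' hm]
  rw [lintegral_eq_tsum_box] at hfin ⊢
  have h1 : ∀ k, ∫⁻ z in box k, φ z = ∫⁻ z in box 0, φ z := fun k => by
    rw [setLIntegral_box]; simp only [hφ]
  simp only [h1] at hfin ⊢
  by_contra hne
  refine hfin (ENNReal.tsum_const_eq_top_of_ne_zero fun h0 => hne ?_)
  simp [h0]

theorem exists_mem_cell_of_ae {P : Rd d → Prop} (hP : ∀ᵐ z ∂(volume : Measure (Rd d)), P z)
    (x : Rd d) : ∃ z, P z ∧ x ∈ cell z := by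
  have hopen : IsOpen {z : Rd d | x ∈ cell z} :=
    isOpen_setOf_mem_cell.preimage (Continuous.prodMk_left x)
  have hne : {z : Rd d | x ∈ cell z}.Nonempty :=
    ⟨WithLp.toLp 2 fun i => x i - 1 / 2, fun i => by
      constructor
      · show x i - 1 / 2 < x i
        linarith
      · show x i < x i - 1 / 2 + 1
        linarith⟩
  obtain ⟨z, hz1, hz2⟩ := (Measure.dense_of_ae hP).inter_open_nonempty _ hopen hne
  exact ⟨z, hz2, hz1⟩

/-- Almost every corner is enough: corners of full measure are dense, and those whose cell contains
a given point form a nonempty open set. -/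
theorem ae_eq_zero_of_ae_setLIntegral_cell {h : Rd d → ℝ} (hm : AEStronglyMeasurable h volume)
    (hcell : ∀ᵐ z ∂(volume : Measure (Rd d)), ∫⁻ x in cell z, ‖h x‖ₑ = 0) :
    h =ᵐ[volume] 0 := by
  refine measure_null_of_locally_null _ fun x _ => ?_
  obtain ⟨z, hz, hxz⟩ := exists_mem_cell_of_ae hcell x
  refine ⟨cell z ∩ {x | h x = 0}ᶜ, ?_, ?_⟩
  · exact inter_mem_nhdsWithin _ ((isOpen_cell z).mem_nhds hxz) |> fun h => by
      rwa [Set.inter_comm] at h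
  · rw [lintegral_eq_zero_iff' hm.enorm.restrict] at hz
    have h1 : ∀ᵐ x ∂(volume.restrict (cell z)), h x = 0 := by
      filter_upwards [hz] with x hx
      simpa using hx
    rw [ae_restrict_iff' (isOpen_cell z).measurableSet, ae_iff] at h1
    refine measure_mono_null (fun y hy => ?_) h1
    simpa using hy

/-- The local average of `|g₁ - g₂|` is in `L^{p*}` by the triangle inequality and is invariant
under `ℤ^d`, hence zero almost everywhere. -/
theorem ae_eq_of_isPeriodicPart {p : ℝ} (hp : 1 ≤ p) (hpd : p < d) {f g₁ g₂ : Rd d → ℝ}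
    (h₁ : IsPeriodicPart p f g₁) (h₂ : IsPeriodicPart p f g₂) : g₁ =ᵐ[volume] g₂ := by
  have hq : 0 < sobolevExp d p := by linarith [le_sobolevExp hp hpd]
  have : NeZero d := ⟨by have := one_lt_of_lt_cast hp hpd; omega⟩
  set h : Rd d → ℝ := fun x => g₁ x - g₂ x with hdef
  have hloc : LocallyIntegrable h volume := h₁.1.sub h₂.1
  have hper : IsQPeriodic h := fun i => by
    filter_upwards [h₁.2.1 i, h₂.2.1 i] with x hx1 hx2
    rw [hdef]; simp only [hx1, hx2]
  have hLp : MemLp (localAvg fun x => |h x|) (ENNReal.ofReal (sobolevExp d p)) volume := by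
    refine (h₁.2.2.2.add h₂.2.2.2).mono
      (stronglyMeasurable_localAvg hloc.aestronglyMeasurable.norm).aestronglyMeasurable
      (Eventually.of_forall fun z => ?_)
    have hi₁ : IntegrableOn (fun x => |f x - g₁ x|) (cell z) := (integrableOn_cell h₁.2.2.1 z).norm
    have hi₂ : IntegrableOn (fun x => |f x - g₂ x|) (cell z) := (integrableOn_cell h₂.2.2.1 z).norm
    have hle : localAvg (fun x => |h x|) z ≤
        localAvg (fun x => |f x - g₁ x|) z + localAvg (fun x => |f x - g₂ x|) z := by
      simp only [localAvg]
      rw [← integral_add hi₁ hi₂]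
      refine integral_mono (integrableOn_cell hloc z).norm (hi₁.add hi₂) fun x => ?_
      have : h x = (f x - g₂ x) - (f x - g₁ x) := by rw [hdef]; ring
      rw [this]
      exact (abs_sub _ _).trans (add_comm _ _).le
    have h0 : 0 ≤ localAvg (fun x => |h x|) z := integral_nonneg fun _ => abs_nonneg _
    rw [Real.norm_of_nonneg h0]
    exact hle.trans (Real.le_norm_self _)
  have hfin := lintegral_rpow_enorm_lt_top_of_eLpNorm_lt_top (by simpa using hq)
    ENNReal.ofReal_ne_top hLp.2
  rw [ENNReal.toReal_ofReal hq.le] at hfin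
  have hz := ae_eq_zero_of_lintegral_ne_top (hLp.1.enorm.pow_const _) (fun z k => by
    rw [enorm_localAvg_abs hloc, enorm_localAvg_abs hloc,
      setLIntegral_cell_add_latticePoint hper]) hfin.ne
  have hzero : h =ᵐ[volume] 0 := by
    refine ae_eq_zero_of_ae_setLIntegral_cell hloc.aestronglyMeasurable ?_
    filter_upwards [hz] with z hz
    rw [← enorm_localAvg_abs hloc]
    simpa [ENNReal.rpow_eq_zero_iff, hq, hq.not_gt] using hz
  filter_upwards [hzero] with x hx
  exact sub_eq_zero.1 hx

end

/-! ### Lattice means and Hölder regularity -/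

section

variable {d : ℕ}

/-- Cesàro: only finitely many terms exceed `ε / 2`, and dividing their fixed finite sum by the
growing cardinality makes it negligible. The shape of `S N` plays no role. -/
theorem tendsto_mean_of_tendsto_cofinite {ι : Type*} {a : ι → ℝ≥0∞} (ha : ∀ k, a k ≠ ∞)
    (h0 : Tendsto a cofinite (𝓝 0)) {S : ℕ → Finset ι}
    (hS : Tendsto (fun N => (S N).card) atTop atTop) :
    Tendsto (fun N => ((S N).card : ℝ≥0∞)⁻¹ * ∑ k ∈ S N, a k) atTop (𝓝 0) := by
  classical
  rw [ENNReal.tendsto_nhds_zero]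
  intro ε hε
  have hε2 : 0 < ε / 2 := ENNReal.half_pos hε.ne'
  have hT : {k | ¬ a k ≤ ε / 2}.Finite := (ENNReal.tendsto_nhds_zero.1 h0) _ hε2
  set T := hT.toFinset
  have hM : ∑ k ∈ T, a k ≠ ∞ := ENNReal.sum_ne_top.2 fun k _ => ha k
  have hinv : Tendsto (fun N => ((S N).card : ℝ≥0∞)⁻¹ * ∑ k ∈ T, a k) atTop (𝓝 0) := by
    have h1 := ENNReal.tendsto_inv_nat_nhds_zero.comp hS
    have h2 := ENNReal.Tendsto.mul_const h1 (Or.inr hM)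
    rwa [zero_mul] at h2
  filter_upwards [ENNReal.tendsto_nhds_zero.1 hinv _ hε2] with N hN
  have hsum : ∑ k ∈ S N, a k ≤ ∑ k ∈ T, a k + (S N).card * (ε / 2) := by
    rw [← nsmul_eq_mul, ← Finset.sum_const]
    calc ∑ k ∈ S N, a k ≤ ∑ k ∈ S N, ((if k ∈ T then a k else 0) + ε / 2) := by
          refine Finset.sum_le_sum fun k _ => ?_
          split_ifs with hk
          · exact le_self_add
          · rw [zero_add]
            simpa [T] using hk
      _ ≤ _ := by
          rw [Finset.sum_add_distrib]
          gcongr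
          rw [← Finset.sum_filter]
          exact Finset.sum_le_sum_of_subset fun k hk => (Finset.mem_filter.1 hk).2
  calc ((S N).card : ℝ≥0∞)⁻¹ * ∑ k ∈ S N, a k
      ≤ ((S N).card : ℝ≥0∞)⁻¹ * (∑ k ∈ T, a k + (S N).card * (ε / 2)) := by gcongr
    _ = ((S N).card : ℝ≥0∞)⁻¹ * ∑ k ∈ T, a k +
        (((S N).card : ℝ≥0∞)⁻¹ * (S N).card) * (ε / 2) := by ring
    _ ≤ ε / 2 + 1 * (ε / 2) := by
        gcongr
        exact ENNReal.inv_mul_le_one _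
    _ = ε := by rw [one_mul, ENNReal.add_halves]

/-- The `N + 1` points `0, …, N` of one coordinate axis lie in the ball. -/
theorem lt_card_latticeBall [NeZero d] (N : ℕ) : N < (latticeBall d N).card := by
  have hmaps : Set.MapsTo (fun m : ℕ => (Pi.single 0 (m : ℤ) : Fin d → ℤ))
      (Finset.range (N + 1)) (latticeBall d N) := by
    intro m hm
    rw [Finset.mem_coe, mem_latticeBall]
    have : latticePoint (Pi.single 0 (m : ℤ) : Fin d → ℤ) = EuclideanSpace.single 0 (m : ℝ) := by
      ext j
      by_cases h : j = 0
      · subst h; simp [latticePoint_apply]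
      · simp [latticePoint_apply, h]
    rw [this, PiLp.norm_single]
    have : m ≤ N := by simpa [Nat.lt_succ_iff] using hm
    simpa using this
  have hcard := Finset.card_le_card_of_injOn _ hmaps fun a _ b _ hab => by
    simpa using Pi.single_injective _ hab
  rw [Finset.card_range] at hcard
  omega

theorem tendsto_card_latticeBall [NeZero d] :
    Tendsto (fun N => (latticeBall d N).card) atTop atTop :=
  tendsto_atTop_mono (fun N => (lt_card_latticeBall N).le) tendsto_id

theorem enorm_latticeMean_sub_le [NeZero d] (f g : Rd d → ℝ) (N : ℕ) (x : Rd d) :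
    ‖latticeMean f N x - g x‖ₑ ≤ ((latticeBall d N).card : ℝ≥0∞)⁻¹ *
      ∑ k ∈ latticeBall d N, ‖f (x + latticePoint k) - g x‖ₑ := by
  have hpos : 0 < (latticeBall d N).card := (Nat.zero_le N).trans_lt (lt_card_latticeBall N)
  have hne : ((latticeBall d N).card : ℝ) ≠ 0 := by exact_mod_cast hpos.ne'
  have h1 : latticeMean f N x - g x = ((latticeBall d N).card : ℝ)⁻¹ *
      ∑ k ∈ latticeBall d N, (f (x + latticePoint k) - g x) := by
    rw [latticeMean, Finset.sum_sub_distrib, Finset.sum_const, nsmul_eq_mul]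
    field_simp
  rw [h1, enorm_mul, enorm_inv hne, Real.enorm_natCast]
  gcongr
  exact enorm_sum_le _ _

theorem setLIntegral_box_translate_sub {f g : Rd d → ℝ}
    (hg : ∀ x k, g (x + latticePoint k) = g x) (j k : Fin d → ℤ) :
    ∫⁻ x in box j, ‖f (x + latticePoint k) - g x‖ₑ = ∫⁻ x in box (j + k), ‖f x - g x‖ₑ := by
  rw [setLIntegral_box_add]
  simp only [hg]

theorem tendstoL1loc_latticeMean [NeZero d] {f g : Rd d → ℝ}
    (hf : AEStronglyMeasurable f volume) (hgm : AEStronglyMeasurable g volume)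
    (hg : ∀ x k, g (x + latticePoint k) = g x)
    (hfin : ∀ k, ∫⁻ x in box k, ‖f x - g x‖ₑ ≠ ∞)
    (hlim : Tendsto (fun k => ∫⁻ x in box k, ‖f x - g x‖ₑ) cofinite (𝓝 0)) :
    TendstoL1loc (latticeMean f) g := by
  intro K hK
  obtain ⟨J, hJ⟩ := exists_finset_subset_iUnion_box hK
  have hbox : ∀ j ∈ J, Tendsto (fun N => ((latticeBall d N).card : ℝ≥0∞)⁻¹ *
      ∑ k ∈ latticeBall d N, ∫⁻ x in box (j + k), ‖f x - g x‖ₑ) atTop (𝓝 0) := fun j _ =>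
    tendsto_mean_of_tendsto_cofinite (fun k => hfin (j + k))
      (hlim.comp (add_right_injective j).tendsto_cofinite) tendsto_card_latticeBall
  have hsum := tendsto_finsetSum J hbox
  rw [Finset.sum_const_zero] at hsum
  refine tendsto_of_tendsto_of_tendsto_of_le_of_le tendsto_const_nhds hsum
    (fun _ => zero_le) fun N => ?_
  refine (lintegral_mono_set hJ).trans ((setLIntegral_biUnion_finset_le _ _ _).trans
    (Finset.sum_le_sum fun j _ => ?_))
  have hpos : 0 < (latticeBall d N).card := (Nat.zero_le N).trans_lt (lt_card_latticeBall N)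
  refine (lintegral_mono fun x => enorm_latticeMean_sub_le f g N x).trans ?_
  rw [lintegral_const_mul' _ _ (by simpa using hpos.ne'), lintegral_finsetSum']
  · simp only [setLIntegral_box_translate_sub hg]
    exact le_rfl
  · intro k _
    exact (((hf.comp_quasiMeasurePreserving (measurePreserving_add_right volume
      (latticePoint k)).quasiMeasurePreserving).sub hgm).enorm).restrict

/-- If the translates of `f` converge to `g` in `L^1` of the cubes, some sequence of them converges
almost everywhere. -/
theorem exists_seq_tendsto_ae [NeZero d] {f g : Rd d → ℝ}
    (hf : AEStronglyMeasurable f volume) (hgm : AEStronglyMeasurable g volume)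
    (hg : ∀ x k, g (x + latticePoint k) = g x)
    (hfin : ∀ k, ∫⁻ x in box k, ‖f x - g x‖ₑ ≠ ∞)
    (hlim : Tendsto (fun k => ∫⁻ x in box k, ‖f x - g x‖ₑ) cofinite (𝓝 0)) :
    ∃ k : ℕ → Fin d → ℤ, ∀ᵐ x ∂(volume : Measure (Rd d)),
      Tendsto (fun n => f (x + latticePoint (k n))) atTop (𝓝 (g x)) := by
  -- Diagonal choice with summable tolerances: the `n`-th translate is good on every box of code at
  -- most `n`, so on a given box the errors are summable once finitely many `n` are set aside.
  obtain ⟨δ, hδ0, hδ⟩ := ENNReal.exists_pos_sum_of_countable' (ε := 1) one_ne_zero ℕ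
  have hex : ∀ n : ℕ, ∃ k : Fin d → ℤ, ∀ j, Encodable.encode j ≤ n →
      ∫⁻ x in box (j + k), ‖f x - g x‖ₑ ≤ δ n := by
    intro n
    have hfinite : {j : Fin d → ℤ | Encodable.encode j ≤ n}.Finite :=
      (Set.finite_Iic n).preimage Encodable.encode_injective.injOn
    have hev : ∀ᶠ k in cofinite, ∀ j ∈ {j : Fin d → ℤ | Encodable.encode j ≤ n},
        ∫⁻ x in box (j + k), ‖f x - g x‖ₑ ≤ δ n := by
      rw [eventually_all_finite hfinite]
      intro j _
      exact ENNReal.tendsto_nhds_zero.1 (hlim.comp (add_right_injective j).tendsto_cofinite) _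
        (hδ0 n)
    exact hev.exists
  choose k hk using hex
  refine ⟨k, ?_⟩
  have hm : ∀ n, AEMeasurable (fun x => ‖f (x + latticePoint (k n)) - g x‖ₑ) volume := fun n =>
    ((hf.comp_quasiMeasurePreserving (measurePreserving_add_right volume
      (latticePoint (k n))).quasiMeasurePreserving).sub hgm).enorm
  rw [← Measure.restrict_univ (μ := (volume : Measure (Rd d))), ← iUnion_box,
    ae_restrict_iUnion_iff]
  intro j
  have hsum : ∫⁻ x in box j, ∑' n, ‖f (x + latticePoint (k n)) - g x‖ₑ ≠ ∞ := by
    rw [lintegral_tsum fun n => (hm n).restrict]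
    simp only [setLIntegral_box_translate_sub hg]
    set m := Encodable.encode j
    rw [← Summable.sum_add_tsum_nat_add' (k := m) ENNReal.summable]
    refine ENNReal.add_ne_top.2 ⟨ENNReal.sum_ne_top.2 fun n _ => hfin _, ?_⟩
    refine ne_top_of_le_ne_top (hδ.trans ENNReal.one_lt_top).ne ?_
    exact (ENNReal.tsum_le_tsum fun n => hk (n + m) j (Nat.le_add_left m n)).trans
      (ENNReal.tsum_comp_le_tsum_of_injective (add_left_injective m) δ)
  filter_upwards [ae_lt_top' (AEMeasurable.tsum fun n => (hm n).restrict) hsum] with x hx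
  have h0 := ENNReal.tendsto_atTop_zero_of_tsum_ne_top hx.ne
  rw [tendsto_iff_edist_tendsto_0]
  simpa only [edist_eq_enorm_sub] using h0

/-- The translates of the continuous representative `u` are known to converge only almost
everywhere. A limit along an ultrafilter exists at every point, as `u` is bounded; it keeps both
constants and agrees with `g` wherever the sequence converges to `g`. -/
theorem memHolder_of_tendsto_ae {f g : Rd d → ℝ} {k : ℕ → Fin d → ℤ}
    (hk : ∀ᵐ x ∂(volume : Measure (Rd d)),
      Tendsto (fun n => f (x + latticePoint (k n))) atTop (𝓝 (g x)))
    {α : ℝ} (hf : MemHolder α f) : MemHolder α g := by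
  obtain ⟨u, huf, ⟨M, hM⟩, C, hC⟩ := hf
  have hex : ∀ x, ∃ y, Tendsto (fun n => u (x + latticePoint (k n))) (hyperfilter ℕ : Filter ℕ)
      (𝓝 y) := by
    intro x
    obtain ⟨y, -, hy⟩ := (isCompact_Icc (a := -M) (b := M)).ultrafilter_le_nhds
      ((hyperfilter ℕ).map fun n => u (x + latticePoint (k n)))
      (by
        rw [Ultrafilter.coe_map, le_principal_iff, mem_map]
        exact univ_mem' fun n => abs_le.1 (hM _))
    exact ⟨y, hy⟩
  choose v hv using hex
  refine ⟨v, ?_, ⟨M, fun x => ?_⟩, C, fun x y => ?_⟩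
  · have hall : ∀ᵐ x ∂(volume : Measure (Rd d)), ∀ n,
        u (x + latticePoint (k n)) = f (x + latticePoint (k n)) := by
      rw [ae_all_iff]
      intro n
      exact (measurePreserving_add_right volume
        (latticePoint (k n))).quasiMeasurePreserving.ae huf
    filter_upwards [hk, hall] with x hx1 hx2
    simp only [← hx2] at hx1
    exact tendsto_nhds_unique (hv x) (hx1.mono_left Nat.hyperfilter_le_atTop)
  · exact le_of_tendsto' (hv x).abs fun n => hM _
  · refine le_of_tendsto' ((hv x).sub (hv y)).abs fun n => ?_
    simpa using hC (x + latticePoint (k n)) (y + latticePoint (k n))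

end

end DiscreteGradient

/-! ### Proof of the proposition -/

theorem proposition2p9 (d : ℕ) (p : ℝ) (hp : 1 ≤ p) (hpd : p < (d : ℝ))
    (f : DiscreteGradient.Rd d → ℝ) (hf : DiscreteGradient.MemBoldA p f)
    (hbdd : MemLp f ⊤ volume) :
    ∃ fper : DiscreteGradient.Rd d → ℝ,
      DiscreteGradient.IsPeriodicPart p f fper ∧
      (∀ g : DiscreteGradient.Rd d → ℝ,
        DiscreteGradient.IsPeriodicPart p f g → g =ᵐ[volume] fper) ∧
      DiscreteGradient.TendstoL1loc (DiscreteGradient.latticeMean f) fper ∧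
      ∀ α : ℝ, 0 < α → α < 1 →
        DiscreteGradient.MemHolder α f → DiscreteGradient.MemHolder α fper := by
  have : NeZero d := ⟨by have := DiscreteGradient.one_lt_of_lt_cast hp hpd; omega⟩
  have hq : 0 < DiscreteGradient.sobolevExp d p := by
    linarith [DiscreteGradient.le_sobolevExp hp hpd]
  obtain ⟨c, hcm, hci, hsum⟩ := DiscreteGradient.exists_translation_limit hp hpd hf
  set g := DiscreteGradient.periodicExt c with hg
  have hgper : ∀ x k, g (x + DiscreteGradient.latticePoint k) = g x :=
    DiscreteGradient.periodicExt_add_latticePoint c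
  have hgm : AEStronglyMeasurable g volume :=
    (DiscreteGradient.measurable_periodicExt hcm).aestronglyMeasurable
  have hgloc : LocallyIntegrable g volume := DiscreteGradient.locallyIntegrable_periodicExt hci
  have hloc : LocallyIntegrable (fun x => f x - g x) volume := hf.1.sub hgloc
  -- Moves the summability from translates on the unit box to `f - g` on all boxes, by periodicity
  -- of `g`.
  have hbox : ∀ k, ∫⁻ x in DiscreteGradient.box 0,
      ‖f (x + DiscreteGradient.latticePoint k) - c x‖ₑ =
        ∫⁻ x in DiscreteGradient.box k, ‖f x - g x‖ₑ := by
    intro k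
    rw [DiscreteGradient.setLIntegral_box (g := fun x => ‖f x - g x‖ₑ)]
    refine setLIntegral_congr_fun (DiscreteGradient.measurableSet_box 0) fun x hx => ?_
    simp only [hgper]
    rw [hg, DiscreteGradient.periodicExt_of_mem_box_zero c hx]
  simp only [hbox] at hsum
  have hfin : ∀ k, ∫⁻ x in DiscreteGradient.box k, ‖f x - g x‖ₑ ≠ ∞ := fun k =>
    (DiscreteGradient.integrableOn_box hloc k).2.ne
  have hlim : Tendsto (fun k => ∫⁻ x in DiscreteGradient.box k, ‖f x - g x‖ₑ) cofinite
      (𝓝 0) := by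
    have h := (ENNReal.tendsto_cofinite_zero_of_tsum_ne_top hsum).ennrpow_const
      (1 / DiscreteGradient.sobolevExp d p)
    simpa [← ENNReal.rpow_mul, hq.ne', hq] using h
  have hpart : DiscreteGradient.IsPeriodicPart p f g :=
    ⟨hgloc, DiscreteGradient.isQPeriodic_periodicExt c, hloc,
      DiscreteGradient.memLp_localAvg_abs hq hloc hsum⟩
  refine ⟨g, hpart, fun g' hg' => DiscreteGradient.ae_eq_of_isPeriodicPart hp hpd hg' hpart,
    DiscreteGradient.tendstoL1loc_latticeMean hf.1.aestronglyMeasurable hgm hgper hfin hlim,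
    fun α _ _ hα => ?_⟩
  obtain ⟨k, hk⟩ := DiscreteGradient.exists_seq_tendsto_ae hf.1.aestronglyMeasurable hgm hgper
    hfin hlim
  exact DiscreteGradient.memHolder_of_tendsto_ae hk hα
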